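/- Let $\mathbb K$ be $\mathbb R$ or $\mathbb C$; all Banach spaces are over $\mathbb K$. For Banach spaces $X,Y$ the Kadets distance $d_K(X,Y)$ is the infimum of the Hausdorff distances between the closed unit balls of $UX$ and $VY$, over all Banach spaces $Z$ and all linear isometric embeddings $U:X\to Z$, $V:Y\to Z$. A property $\mathcal P$ of Banach spaces is called clopen if, for every cardinal $\aleph$, the set of Banach spaces of density character at most $\aleph$ with property $\mathcal P$ is both open and closed, for the pseudo-metric $d_K$, in the set of all Banach spaces of density character at most $\aleph$. The Kadets component $\mathcal C_X$ of a Banach space $X$ is the intersection of all clopen properties containing $X$. **Proposition 5.8.** For every Banach space $X$, we have $X\in\mathcal C_{\ell_1}$ if and only if $X$ is separable and contains a (closed linear) subspace isomorphic to $\ell_1$. -/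

import Mathlib

open Metric Cardinal

universe u

namespace KadetsDistance

/-- A (bundled) Banach space over `𝕜`, where `𝕜` is `ℝ` or `ℂ`. -/
structure BanachSpace (𝕜 : Type u) [RCLike 𝕜] where
  carrier : Type u
  [normedAddCommGroup : NormedAddCommGroup carrier]
  [normedSpace : NormedSpace 𝕜 carrier]
  [completeSpace : CompleteSpace carrier]

attribute [instance] BanachSpace.normedAddCommGroup BanachSpace.normedSpace
  BanachSpace.completeSpace

instance (𝕜 : Type u) [RCLike 𝕜] : CoeSort (BanachSpace 𝕜) (Type u) :=
  ⟨BanachSpace.carrier⟩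

section

variable {𝕜 : Type u} [RCLike 𝕜]

/-- The gap (or opening) of two subspaces `E`, `F` of a normed space `Z`: the Hausdorff distance
between their closed unit balls. -/
noncomputable def gap {Z : Type u} [NormedAddCommGroup Z] [NormedSpace 𝕜 Z]
    (E F : Submodule 𝕜 Z) : ℝ :=
  hausdorffDist (closedBall (0 : Z) 1 ∩ E) (closedBall (0 : Z) 1 ∩ F)

/-- The Kadets distance of `X` and `Y`: the infimum of the gaps of `U X` and `V Y` over all Banach
spaces `Z` and all linear isometric embeddings `U : X → Z` and `V : Y → Z`. -/
noncomputable def kadetsDist (X Y : BanachSpace 𝕜) : ℝ :=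
  sInf {r : ℝ | ∃ (Z : BanachSpace 𝕜) (U : X →ₗᵢ[𝕜] Z) (V : Y →ₗᵢ[𝕜] Z),
    r = gap (LinearMap.range U.toLinearMap) (LinearMap.range V.toLinearMap)}

/-- The class of Banach spaces with density character at most `κ`, i.e. having a dense subset
of cardinality at most `κ`. -/
def BanachOfDensityLE (𝕜 : Type u) [RCLike 𝕜] (κ : Cardinal.{u}) : Type (u + 1) :=
  {X : BanachSpace 𝕜 // ∃ s : Set X, Dense s ∧ #s ≤ κ}

/-- The topology of the Kadets (pseudo-)metric on the Banach spaces of density character at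
most `κ`: a set is open if with each point it contains a ball around that point. -/
instance kadetsTopology (𝕜 : Type u) [RCLike 𝕜] (κ : Cardinal.{u}) :
    TopologicalSpace (BanachOfDensityLE 𝕜 κ) where
  IsOpen s := ∀ X ∈ s, ∃ ε > 0, ∀ Y : BanachOfDensityLE 𝕜 κ, kadetsDist X.1 Y.1 < ε → Y ∈ s
  isOpen_univ := fun _ _ => ⟨1, one_pos, fun _ _ => trivial⟩
  isOpen_inter := by
    rintro s t hs ht X ⟨hXs, hXt⟩
    obtain ⟨ε, hε, h⟩ := hs X hXs
    obtain ⟨δ, hδ, h'⟩ := ht X hXt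
    exact ⟨min ε δ, lt_min hε hδ, fun Y hY =>
      ⟨h Y (hY.trans_le (min_le_left _ _)), h' Y (hY.trans_le (min_le_right _ _))⟩⟩
  isOpen_sUnion := by
    rintro S hS X ⟨s, hs, hX⟩
    obtain ⟨ε, hε, h⟩ := hS s hs X hX
    exact ⟨ε, hε, fun Y hY => ⟨s, hs, h Y hY⟩⟩

/-- A property `P` of Banach spaces is clopen if for each cardinal `κ` the set of Banach spaces
with `P` of density character at most `κ` is clopen for the Kadets pseudo-metric. -/
def IsClopenProperty (P : Set (BanachSpace 𝕜)) : Prop :=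
  ∀ κ : Cardinal.{u}, IsClopen {X : BanachOfDensityLE 𝕜 κ | X.1 ∈ P}

/-- The (Kadets) component of `X`: the intersection of all clopen properties containing `X`. -/
def kadetsComponent (X : BanachSpace 𝕜) : Set (BanachSpace 𝕜) :=
  ⋂₀ {P | IsClopenProperty P ∧ X ∈ P}

/-- The Banach space `ℓ₁` over `𝕜`. -/
noncomputable def ellOne (𝕜 : Type u) [RCLike 𝕜] : BanachSpace 𝕜 where
  carrier := lp (fun _ : ℕ => 𝕜) 1

/-- `X` contains a copy of `E`: some linear subspace of `X` is linearly homeomorphic to `E`. -/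
def ContainsCopy (X E : BanachSpace 𝕜) : Prop :=
  ∃ F : Submodule 𝕜 X, Nonempty (E ≃L[𝕜] F)

end

end KadetsDistance

namespace KadetsDistance

/-! ### Linked spaces, and paths of kernels -/

section Linked

variable {𝕜 : Type u} [RCLike 𝕜]

/-! Being separable and containing `ℓ₁` is a clopen property because it passes between spaces at
distance below `1/4`. By James' distortion theorem (`IsEllOneSeq.improve`) any copy of `ℓ₁` contains
one with lower constant `1/2`, and a perturbation below `1/4` leaves a positive constant.
Separability is transferred by Riesz's lemma.

Conversely, let `Q : E → X` be onto. The operators `(e, x) ↦ (1 - t) Q e - t x` are uniformly open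
and depend continuously on `t`, so their kernels form a path from `ker Q × X` to `E`, and no clopen
property separates its ends (`linked_ker_prod`). Applied to `X → X/F` with `F ≅ ℓ₁`, this links `X`
with `ℓ₁ × Y`, where `Y = X/F` is separable. To absorb `Y` (`linked_ellOne_prod`), let `W = ℓ₁(Y)`.
It is a quotient of `ℓ₁`, with kernel `M` say, and `W ≅ W × Y`; so both `ℓ₁` and `ℓ₁ × Y` map onto
`W` with kernel `M`, and both are linked with `M × W`. -/

theorem gap_nonneg {Z : Type u} [NormedAddCommGroup Z] [NormedSpace 𝕜 Z]
    (E F : Submodule 𝕜 Z) : 0 ≤ gap E F := hausdorffDist_nonneg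

theorem gap_comm {Z : Type u} [NormedAddCommGroup Z] [NormedSpace 𝕜 Z]
    (E F : Submodule 𝕜 Z) : gap E F = gap F E := hausdorffDist_comm

theorem kadetsDist_le_gap {X Y Z : BanachSpace 𝕜} (U : X →ₗᵢ[𝕜] Z) (V : Y →ₗᵢ[𝕜] Z) :
    kadetsDist X Y ≤ gap (LinearMap.range U.toLinearMap) (LinearMap.range V.toLinearMap) := by
  refine csInf_le ⟨0, ?_⟩ ⟨Z, U, V, rfl⟩
  rintro r ⟨Z, U, V, rfl⟩
  exact gap_nonneg _ _

theorem kadetsDist_comm (X Y : BanachSpace 𝕜) : kadetsDist X Y = kadetsDist Y X := by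
  unfold kadetsDist
  congr 1
  ext r
  constructor
  · rintro ⟨Z, U, V, rfl⟩
    exact ⟨Z, V, U, gap_comm _ _⟩
  · rintro ⟨Z, U, V, rfl⟩
    exact ⟨Z, V, U, gap_comm _ _⟩

theorem exists_embeddings_gap (X Y : BanachSpace 𝕜) :
    {r : ℝ | ∃ (Z : BanachSpace 𝕜) (U : X →ₗᵢ[𝕜] Z) (V : Y →ₗᵢ[𝕜] Z),
      r = gap (LinearMap.range U.toLinearMap) (LinearMap.range V.toLinearMap)}.Nonempty := by
  let U : X →ₗᵢ[𝕜] X × Y := ⟨LinearMap.inl 𝕜 X Y, fun x => by simp [Prod.norm_def]⟩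
  let V : Y →ₗᵢ[𝕜] X × Y := ⟨LinearMap.inr 𝕜 X Y, fun x => by simp [Prod.norm_def]⟩
  exact ⟨_, ⟨X × Y⟩, U, V, rfl⟩

/-- Points of the unit ball of `X` are close to points of the unit ball of `Y` in a suitable
common superspace. -/
theorem exists_embeddings_of_kadetsDist_lt {X Y : BanachSpace 𝕜} {ε : ℝ}
    (h : kadetsDist X Y < ε) :
    ∃ (Z : BanachSpace 𝕜) (U : X →ₗᵢ[𝕜] Z) (V : Y →ₗᵢ[𝕜] Z),
      ∀ x : X, ‖x‖ ≤ 1 → ∃ y : Y, ‖y‖ ≤ 1 ∧ ‖U x - V y‖ < ε := by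
  obtain ⟨_, ⟨Z, U, V, rfl⟩, hr⟩ := exists_lt_of_csInf_lt (exists_embeddings_gap X Y) h
  refine ⟨Z, U, V, fun x hx => ?_⟩
  -- `hausdorffDist` takes the value `0` when the extended distance is infinite, so finiteness must
  -- be checked.
  have hfin : hausdorffEDist
      (closedBall (0 : Z) 1 ∩ (LinearMap.range U.toLinearMap : Submodule 𝕜 Z))
      (closedBall (0 : Z) 1 ∩ (LinearMap.range V.toLinearMap : Submodule 𝕜 Z)) ≠ ⊤ := by
    apply hausdorffEDist_ne_top_of_nonempty_of_bounded
    · exact Set.nonempty_of_mem (x := (0 : Z)) ⟨by simp, Submodule.zero_mem _⟩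
    · exact Set.nonempty_of_mem (x := (0 : Z)) ⟨by simp, Submodule.zero_mem _⟩
    · exact isBounded_closedBall.subset Set.inter_subset_left
    · exact isBounded_closedBall.subset Set.inter_subset_left
  have hmem : U x ∈ closedBall (0 : Z) 1 ∩ (LinearMap.range U.toLinearMap : Submodule 𝕜 Z) :=
    ⟨by simpa using hx, x, rfl⟩
  obtain ⟨_, ⟨hy, y, rfl⟩, hd⟩ := exists_dist_lt_of_hausdorffDist_lt hmem hr hfin
  exact ⟨y, by simpa using hy, by simpa [dist_eq_norm] using hd⟩

/-- Two Banach spaces are linked if no clopen property separates them. -/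
def Linked (X Y : BanachSpace 𝕜) : Prop :=
  ∀ P : Set (BanachSpace 𝕜), IsClopenProperty P → (X ∈ P ↔ Y ∈ P)

theorem Linked.symm {X Y : BanachSpace 𝕜} (h : Linked X Y) : Linked Y X :=
  fun P hP => (h P hP).symm

theorem Linked.trans {X Y Z : BanachSpace 𝕜} (h : Linked X Y) (h' : Linked Y Z) : Linked X Z :=
  fun P hP => (h P hP).trans (h' P hP)

theorem Linked.mem_component {X Y : BanachSpace 𝕜} (h : Linked X Y) : Y ∈ kadetsComponent X :=
  fun P hP => (h P hP.1).1 hP.2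

/-- A family of Banach spaces of bounded cardinality which is continuous for the Kadets distance
and parametrized by a connected space has linked members. -/
theorem linked_of_path {T : Type*} [TopologicalSpace T] [PreconnectedSpace T]
    (F : T → BanachSpace 𝕜) {κ : Cardinal.{u}} (hκ : ∀ t, #(F t) ≤ κ)
    (hF : ∀ t, ∀ ε > 0, ∀ᶠ s in nhds t, kadetsDist (F t) (F s) < ε) (s t : T) :
    Linked (F s) (F t) := by
  intro P hP
  -- Clopenness is stated one cardinal at a time, so a single bound must serve the whole path; the
  -- full space is used as the dense set.
  let G : T → BanachOfDensityLE 𝕜 κ := fun t =>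
    ⟨F t, Set.univ, dense_univ, by rw [Cardinal.mk_univ]; exact hκ t⟩
  have hG : Continuous G := by
    refine ⟨fun A hA => isOpen_iff_mem_nhds.2 fun r hr => ?_⟩
    obtain ⟨ε, hε, h⟩ := hA (G r) hr
    filter_upwards [hF r ε hε] with q hq
    exact h (G q) hq
  have hcl : IsClopen {r | F r ∈ P} := (hP κ).preimage hG
  rcases isClopen_iff.1 hcl with h | h
  · exact iff_of_false (fun hs => (h ▸ hs : s ∈ (∅ : Set T))) (fun hs => (h ▸ hs : t ∈ (∅ : Set T)))
  · have hu : ∀ r, F r ∈ P := fun r => by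
      have : r ∈ {r | F r ∈ P} := h ▸ Set.mem_univ r
      exact this
    exact iff_of_true (hu s) (hu t)

/-- Every open set around one of the spaces contains a ball, hence the other space. -/
theorem linked_of_kadetsDist_nonpos {X Y : BanachSpace 𝕜} (h : kadetsDist X Y ≤ 0) :
    Linked X Y := by
  have key : ∀ {X Y : BanachSpace 𝕜}, kadetsDist X Y ≤ 0 → ∀ P : Set (BanachSpace 𝕜),
      IsClopenProperty P → X ∈ P → Y ∈ P := by
    intro X Y h P hP hX
    let κ := max #X #Y
    let X' : BanachOfDensityLE 𝕜 κ :=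
      ⟨X, Set.univ, dense_univ, by rw [Cardinal.mk_univ]; exact le_max_left _ _⟩
    let Y' : BanachOfDensityLE 𝕜 κ :=
      ⟨Y, Set.univ, dense_univ, by rw [Cardinal.mk_univ]; exact le_max_right _ _⟩
    obtain ⟨ε, hε, H⟩ := (hP κ).isOpen X' hX
    exact H Y' (h.trans_lt hε)
  exact fun P hP => ⟨key h P hP, key (kadetsDist_comm X Y ▸ h) P hP⟩

theorem linked_of_range_eq {X Y Z : BanachSpace 𝕜} (U : X →ₗᵢ[𝕜] Z) (V : Y →ₗᵢ[𝕜] Z)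
    (h : LinearMap.range U.toLinearMap = LinearMap.range V.toLinearMap) : Linked X Y := by
  refine linked_of_kadetsDist_nonpos ((kadetsDist_le_gap U V).trans ?_)
  rw [h]
  simp [gap]

/-- A closed subspace of a Banach space, as a Banach space. -/
noncomputable def ofClosed (Z : BanachSpace 𝕜) (F : Submodule 𝕜 Z) (hF : IsClosed (F : Set Z)) :
    BanachSpace 𝕜 :=
  haveI := hF.completeSpace_coe
  ⟨F⟩

theorem linked_ofClosed {X Z : BanachSpace 𝕜} (U : X →ₗᵢ[𝕜] Z) (F : Submodule 𝕜 Z)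
    (hF : IsClosed (F : Set Z)) (h : LinearMap.range U.toLinearMap = F) :
    Linked X (ofClosed Z F hF) := by
  refine linked_of_range_eq (Y := ofClosed Z F hF) U (F.subtypeₗᵢ) ?_
  rw [h]
  exact F.range_subtype.symm

/-- The kernels of close operators are close, as soon as one of them is onto: one half. -/
theorem exists_mem_ker_near {Z X : Type u} [NormedAddCommGroup Z] [NormedSpace 𝕜 Z]
    [NormedAddCommGroup X] [NormedSpace 𝕜 X] {S S' : Z →L[𝕜] X} {C δ : ℝ} (hC : 0 ≤ C)
    (hS' : ∀ x, ∃ z, S' z = x ∧ ‖z‖ ≤ C * ‖x‖) (hδ : ‖S - S'‖ ≤ δ) {z : Z}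
    (hz : z ∈ closedBall (0 : Z) 1 ∩ S.ker) :
    ∃ w ∈ closedBall (0 : Z) 1 ∩ S'.ker, dist z w ≤ 2 * (C * δ) := by
  obtain ⟨hz1, hz2⟩ := hz
  have hz1 : ‖z‖ ≤ 1 := by simpa using hz1
  have hz2 : S z = 0 := hz2
  have hδ0 : 0 ≤ δ := (norm_nonneg _).trans hδ
  -- `S' z` is small, so a small `u` corrects `z` to `z - u` in the kernel of `S'`; rescaling into
  -- the unit ball costs at most as much again, hence the factor `2`.
  obtain ⟨u, hu, hun⟩ := hS' (S' z)
  have hS'z : ‖S' z‖ ≤ δ := by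
    have h1 : ‖(S - S') z‖ ≤ δ * 1 :=
      ((S - S').le_opNorm z).trans (mul_le_mul hδ hz1 (norm_nonneg _) hδ0)
    simpa [hz2] using h1
  have hun : ‖u‖ ≤ C * δ := hun.trans (by gcongr)
  set η := C * δ with hη
  have hη0 : 0 ≤ η := by positivity
  have hw : ‖z - u‖ ≤ 1 + η := (norm_sub_le _ _).trans (by linarith)
  have hpos : 0 < 1 + η := by linarith
  have hc : ‖(((1 + η)⁻¹ : ℝ) : 𝕜)‖ = (1 + η)⁻¹ := by
    rw [RCLike.norm_ofReal, abs_of_pos (by positivity)]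
  refine ⟨(((1 + η)⁻¹ : ℝ) : 𝕜) • (z - u), ⟨?_, ?_⟩, ?_⟩
  · rw [mem_closedBall, dist_zero_right, norm_smul, hc, inv_mul_le_iff₀ hpos]
    linarith
  · have : S' ((((1 + η)⁻¹ : ℝ) : 𝕜) • (z - u)) = 0 := by simp [hu]
    exact this
  · have hone : (((1 + η)⁻¹ : ℝ) : 𝕜) * ((1 + η : ℝ) : 𝕜) = 1 := by
      rw [← RCLike.ofReal_mul, inv_mul_cancel₀ hpos.ne', RCLike.ofReal_one]
    have heq : z - (((1 + η)⁻¹ : ℝ) : 𝕜) • (z - u) =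
        (((1 + η)⁻¹ : ℝ) : 𝕜) • ((η : 𝕜) • z + u) := by
      have : z = (((1 + η)⁻¹ : ℝ) : 𝕜) • (((1 + η : ℝ) : 𝕜) • z) := by
        rw [smul_smul, hone, one_smul]
      nth_rewrite 1 [this]
      rw [← smul_sub]
      congr 1
      push_cast
      rw [add_smul, one_smul]
      abel
    rw [dist_eq_norm, heq, norm_smul, hc, inv_mul_le_iff₀ hpos]
    have h1 : ‖(η : 𝕜) • z + u‖ ≤ η * 1 + η := by
      refine (norm_add_le _ _).trans (add_le_add ?_ hun)
      rw [norm_smul, RCLike.norm_ofReal, abs_of_nonneg hη0]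
      gcongr
    nlinarith

/-- The kernels of two close, uniformly open operators have a small gap. -/
theorem gap_ker_le {Z X : Type u} [NormedAddCommGroup Z] [NormedSpace 𝕜 Z]
    [NormedAddCommGroup X] [NormedSpace 𝕜 X] {S S' : Z →L[𝕜] X} {C δ : ℝ} (hC : 0 ≤ C)
    (hS : ∀ x, ∃ z, S z = x ∧ ‖z‖ ≤ C * ‖x‖) (hS' : ∀ x, ∃ z, S' z = x ∧ ‖z‖ ≤ C * ‖x‖)
    (hδ : ‖S - S'‖ ≤ δ) : gap S.ker S'.ker ≤ 2 * (C * δ) := by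
  have hδ0 : 0 ≤ δ := (norm_nonneg _).trans hδ
  refine hausdorffDist_le_of_mem_dist (by positivity) (fun z hz => ?_) (fun z hz => ?_)
  · exact exists_mem_ker_near hC hS' hδ hz
  · exact exists_mem_ker_near hC hS (by rwa [norm_sub_rev]) hz

/-- The operator `(e, x) ↦ (1 - t) Q e - t x` on `E × X`. For `t = 0` its kernel is
`ker Q × X`, for `t = 1` it is `E × 0`. -/
noncomputable def pathOp {E X : Type u} [NormedAddCommGroup E] [NormedSpace 𝕜 E]
    [NormedAddCommGroup X] [NormedSpace 𝕜 X] (Q : E →L[𝕜] X) (t : ℝ) : (E × X) →L[𝕜] X :=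
  (((1 - t : ℝ) : 𝕜) • Q.comp (ContinuousLinearMap.fst 𝕜 E X)) -
    ((t : 𝕜) • ContinuousLinearMap.snd 𝕜 E X)

theorem pathOp_apply {E X : Type u} [NormedAddCommGroup E] [NormedSpace 𝕜 E]
    [NormedAddCommGroup X] [NormedSpace 𝕜 X] (Q : E →L[𝕜] X) (t : ℝ) (e : E) (x : X) :
    pathOp Q t (e, x) = ((1 - t : ℝ) : 𝕜) • Q e - (t : 𝕜) • x := rfl

theorem continuous_pathOp {E X : Type u} [NormedAddCommGroup E] [NormedSpace 𝕜 E]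
    [NormedAddCommGroup X] [NormedSpace 𝕜 X] (Q : E →L[𝕜] X) : Continuous (pathOp Q) := by
  have h : Continuous fun t : ℝ => ((t : ℝ) : 𝕜) := RCLike.continuous_ofReal
  exact ((h.comp (by fun_prop : Continuous fun t : ℝ => 1 - t)).smul continuous_const).sub
    (h.smul continuous_const)

/-- One of the coefficients `1 - t`, `t` is at least `1/2`, and the corresponding term alone is
already onto, with constant `2C` or `2`. The bound is independent of `t`, as the gap estimate
requires. -/
theorem pathOp_open {E X : Type u} [NormedAddCommGroup E] [NormedSpace 𝕜 E]
    [NormedAddCommGroup X] [NormedSpace 𝕜 X] (Q : E →L[𝕜] X) {C : ℝ} (hC : 0 < C)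
    (hQ : ∀ x, ∃ e, Q e = x ∧ ‖e‖ ≤ C * ‖x‖) (t : ℝ) (x : X) :
    ∃ z, pathOp Q t z = x ∧ ‖z‖ ≤ (2 * C + 2) * ‖x‖ := by
  rcases le_total t (1 / 2) with h | h
  · obtain ⟨e, he, hn⟩ := hQ x
    have hpos : 0 < 1 - t := by linarith
    have hne : ((1 - t : ℝ) : 𝕜) ≠ 0 := RCLike.ofReal_ne_zero.2 hpos.ne'
    refine ⟨((((1 - t : ℝ) : 𝕜)⁻¹) • e, 0), ?_, ?_⟩
    · rw [pathOp_apply, map_smul, smul_smul, mul_inv_cancel₀ hne, he]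
      simp
    · have h2 : (1 - t)⁻¹ ≤ 2 := by
        rw [inv_le_comm₀ hpos two_pos]; linarith
      rw [Prod.norm_def]
      simp only [norm_zero, norm_smul, norm_inv, RCLike.norm_ofReal, abs_of_pos hpos]
      have h3 := mul_le_mul h2 hn (norm_nonneg e) two_pos.le
      refine max_le ?_ (by positivity)
      nlinarith [norm_nonneg x]
  · have hpos : 0 < t := by linarith
    have hne : (t : 𝕜) ≠ 0 := RCLike.ofReal_ne_zero.2 hpos.ne'
    refine ⟨(0, -((t : 𝕜)⁻¹ • x)), ?_, ?_⟩
    · rw [pathOp_apply, smul_neg, smul_smul, mul_inv_cancel₀ hne]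
      simp
    · have h2 : t⁻¹ ≤ 2 := by
        rw [inv_le_comm₀ hpos two_pos]; linarith
      rw [Prod.norm_def]
      simp only [norm_zero, norm_neg, norm_smul, norm_inv, RCLike.norm_ofReal, abs_of_pos hpos]
      have h3 := mul_le_mul_of_nonneg_right h2 (norm_nonneg x)
      refine max_le (by positivity) ?_
      nlinarith [norm_nonneg x]

/-- If `Q : E → X` is onto and `j` is an isometry of `M` onto its kernel, then `E` is linked with
`M × X`. -/
theorem linked_ker_prod {E X M : BanachSpace 𝕜} (Q : E →L[𝕜] X) (hQ : Function.Surjective Q)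
    (j : M →ₗᵢ[𝕜] E) (hj : LinearMap.range j.toLinearMap = Q.ker) :
    Linked E ⟨M × X⟩ := by
  obtain ⟨C, hC, hCQ⟩ := Q.exists_preimage_norm_le hQ
  let Z : BanachSpace 𝕜 := ⟨E × X⟩
  let S : Set.Icc (0 : ℝ) 1 → (Z →L[𝕜] X) := fun t => pathOp Q t
  have hScont : Continuous S := (continuous_pathOp Q).comp continuous_subtype_val
  have hcl : ∀ t, IsClosed ((S t).ker : Set Z) := fun t => (S t).isClosed_ker
  let F : Set.Icc (0 : ℝ) 1 → BanachSpace 𝕜 := fun t => ofClosed Z (S t).ker (hcl t)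
  have hpath := linked_of_path F (κ := #Z) (fun t => Cardinal.mk_subtype_le _) (by
    intro t ε hε
    have hK : 0 < 2 * (2 * C + 2) := by positivity
    have hnear : ∀ᶠ s in nhds t, ‖S t - S s‖ < ε / (2 * (2 * C + 2)) := by
      have := (Metric.continuous_iff'.1 hScont) t (ε / (2 * (2 * C + 2))) (by positivity)
      filter_upwards [this] with s hs
      rwa [dist_comm, dist_eq_norm] at hs
    filter_upwards [hnear] with s hs
    have hle : kadetsDist (F t) (F s) ≤ gap (S t).ker (S s).ker := by
      have := kadetsDist_le_gap (X := F t) (Y := F s) (Z := Z)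
        ((S t).ker.subtypeₗᵢ) ((S s).ker.subtypeₗᵢ)
      have h1 : ∀ r, LinearMap.range ((S r).ker.subtypeₗᵢ).toLinearMap = (S r).ker :=
        fun r => (S r).ker.range_subtype
      erw [h1 t, h1 s] at this
      exact this
    refine hle.trans_lt ((gap_ker_le (C := 2 * C + 2) (by positivity)
      (pathOp_open Q hC hCQ t) (pathOp_open Q hC hCQ s) le_rfl).trans_lt ?_)
    rw [lt_div_iff₀ hK] at hs
    linarith) ⟨1, by simp⟩ ⟨0, by simp⟩
  have h1 : Linked E (F ⟨1, by simp⟩) := by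
    refine linked_ofClosed (Z := Z) ⟨LinearMap.inl 𝕜 E X, fun x => by simp [Prod.norm_def, Z]⟩ _ _ ?_
    ext ⟨e, x⟩
    have hmem : (e, x) ∈ (S ⟨1, by simp⟩).ker ↔ x = 0 := by
      change pathOp Q 1 (e, x) = 0 ↔ _
      simp [pathOp_apply]
    rw [hmem]
    constructor
    · rintro ⟨e', h⟩
      exact (congrArg Prod.snd h).symm
    · rintro rfl
      exact ⟨e, rfl⟩
  have h0 : Linked ⟨M × X⟩ (F ⟨0, by simp⟩) := by
    refine linked_ofClosed (Z := Z) (X := ⟨M × X⟩)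
      ⟨LinearMap.prodMap j.toLinearMap LinearMap.id, fun x => by simp [Prod.norm_def, Z]⟩ _ _ ?_
    ext ⟨e, x⟩
    have hmem : (e, x) ∈ (S ⟨0, by simp⟩).ker ↔ e ∈ LinearMap.range j.toLinearMap := by
      rw [hj]
      change pathOp Q 0 (e, x) = 0 ↔ Q e = 0
      simp [pathOp_apply]
    rw [hmem]
    constructor
    · rintro ⟨⟨m, x'⟩, h⟩
      exact ⟨m, congrArg Prod.fst h⟩
    · rintro ⟨m, hm⟩
      exact ⟨(m, x), Prod.ext hm rfl⟩
  exact (h1.trans hpath).trans h0.symm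

/-- Isomorphic Banach spaces are linked. -/
theorem linked_of_equiv {X Y : BanachSpace 𝕜} (e : X ≃L[𝕜] Y) : Linked X Y := by
  -- The isomorphism is an onto map with kernel `0`, so the path of kernels joins `X` to `0 × Y`.
  let M : BanachSpace 𝕜 := ⟨PUnit⟩
  have h1 : Linked X ⟨M × Y⟩ := by
    refine linked_ker_prod (M := M) (e : X →L[𝕜] Y) e.surjective ⟨0, fun x => by
      rw [Subsingleton.elim x 0]; simp⟩ ?_
    ext x
    constructor
    · rintro ⟨m, rfl⟩
      exact Submodule.zero_mem _
    · intro hx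
      have hx : e x = 0 := hx
      exact ⟨0, (e.injective (hx.trans (map_zero e).symm)).symm⟩
  have h2 : Linked Y ⟨M × Y⟩ := by
    refine linked_of_range_eq (Z := ⟨M × Y⟩) ⟨LinearMap.inr 𝕜 M Y, fun x => by simp [Prod.norm_def]⟩
      (Y := ⟨M × Y⟩) LinearIsometry.id ?_
    ext ⟨m, y⟩
    constructor
    · intro _
      exact ⟨(m, y), rfl⟩
    · intro _
      exact ⟨y, Prod.ext (Subsingleton.elim (α := PUnit) _ _) rfl⟩
  exact h1.trans h2.symm

end Linked

/-! ### Quotients of `ℓ₁` and vector-valued `ℓ₁` -/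

section EllOne

variable {𝕜 : Type u} [RCLike 𝕜] {Y : Type u} [NormedAddCommGroup Y] [NormedSpace 𝕜 Y]

theorem hasSum_norm_lp_one (f : lp (fun _ : ℕ => Y) 1) : HasSum (fun i => ‖f i‖) ‖f‖ := by
  simpa using lp.hasSum_norm (p := 1) (by simp) f

theorem memℓp_one_iff {f : ℕ → Y} : Memℓp f 1 ↔ Summable fun i => ‖f i‖ := by
  simpa using memℓp_gen_iff (p := 1) (by simp) (f := f)

/-- The operator `ℓ₁ → Y`, `a ↦ ∑ a n • x n` given by a bounded sequence `x`. -/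
theorem exists_ellOne_operator [CompleteSpace Y] (x : ℕ → Y) {C : ℝ} (hx : ∀ n, ‖x n‖ ≤ C) :
    ∃ T : lp (fun _ : ℕ => 𝕜) 1 →L[𝕜] Y, ∀ a, HasSum (fun n => a n • x n) (T a) := by
  have hs : ∀ a : lp (fun _ : ℕ => 𝕜) 1, Summable fun n => ‖a n • x n‖ := fun a => by
    refine Summable.of_nonneg_of_le (fun _ => norm_nonneg _) (fun n => ?_)
      ((hasSum_norm_lp_one a).summable.mul_right C)
    rw [norm_smul]
    exact mul_le_mul_of_nonneg_left (hx n) (norm_nonneg _)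
  refine ⟨LinearMap.mkContinuous
    { toFun := fun a => ∑' n, a n • x n
      map_add' := fun a b => ?_
      map_smul' := fun c a => ?_ } C fun a => ?_, fun a => (hs a).of_norm.hasSum⟩
  · rw [← (hs a).of_norm.tsum_add (hs b).of_norm]
    simp [add_smul]
  · rw [RingHom.id_apply, ← (hs a).of_norm.tsum_const_smul]
    simp [mul_smul]
  · refine tsum_of_norm_bounded ((hasSum_norm_lp_one a).mul_left C) fun n => ?_
    rw [norm_smul, mul_comm]
    exact mul_le_mul_of_nonneg_right (hx n) (norm_nonneg _)

/-- Finite sums of vectors supported at one coordinate are dense, and those supported at a given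
coordinate form an isometric image of `Y`. Only sums are needed, so the span over `ℕ` suffices. -/
instance separableSpace_lp_one [TopologicalSpace.SeparableSpace Y] :
    TopologicalSpace.SeparableSpace (lp (fun _ : ℕ => Y) 1) := by
  rw [← TopologicalSpace.isSeparable_univ_iff]
  let s : Set (lp (fun _ : ℕ => Y) 1) := ⋃ n, Set.range (lp.single (E := fun _ : ℕ => Y) 1 n)
  have hs : TopologicalSpace.IsSeparable s := TopologicalSpace.IsSeparable.iUnion fun n =>
    TopologicalSpace.isSeparable_range (lp.isometry_single (E := fun _ : ℕ => Y) (p := 1) n).continuous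
  refine (hs.span (R := ℕ)).closure.mono fun f _ => ?_
  refine mem_closure_of_tendsto (lp.hasSum_single ENNReal.one_ne_top f)
    (Filter.Eventually.of_forall fun t => ?_)
  exact Submodule.sum_mem _ fun i _ => Submodule.subset_span (Set.mem_iUnion.2 ⟨i, f i, rfl⟩)

/-- Splitting off the first coordinate of a sequence. -/
theorem nonempty_lp_one_equiv_prod [CompleteSpace Y] :
    Nonempty (lp (fun _ : ℕ => Y) 1 ≃L[𝕜] lp (fun _ : ℕ => Y) 1 × Y) := by
  have htail : ∀ f : lp (fun _ : ℕ => Y) 1, Summable fun n => ‖f (n + 1)‖ := fun f =>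
    (summable_nat_add_iff 1).2 (hasSum_norm_lp_one f).summable
  have hle : ∀ f : lp (fun _ : ℕ => Y) 1, ∑' n, ‖f (n + 1)‖ ≤ ‖f‖ := fun f => by
    rw [← (hasSum_norm_lp_one f).tsum_eq, (hasSum_norm_lp_one f).summable.tsum_eq_zero_add]
    linarith [norm_nonneg (f 0)]
  let L : lp (fun _ : ℕ => Y) 1 →ₗ[𝕜] lp (fun _ : ℕ => Y) 1 × Y :=
    { toFun := fun f => (⟨fun n => f (n + 1), memℓp_one_iff.2 (htail f)⟩, f 0)
      map_add' := fun f g => rfl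
      map_smul' := fun c f => rfl }
  let T := L.mkContinuous 1 fun f => by
    rw [one_mul, Prod.norm_def]
    refine max_le ?_ ?_
    · rw [← (hasSum_norm_lp_one _).tsum_eq]
      exact hle f
    · exact lp.norm_apply_le_norm one_ne_zero f 0
  refine ⟨ContinuousLinearEquiv.ofBijective T ?_ ?_⟩
  · rw [LinearMap.ker_eq_bot]
    intro f g hfg
    ext n
    cases n with
    | zero => exact congrArg Prod.snd hfg
    | succ n => exact congrArg (fun p : lp (fun _ : ℕ => Y) 1 × Y => p.1 n) hfg
  · rw [LinearMap.range_eq_top]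
    rintro ⟨g, y⟩
    let f : ℕ → Y := fun n => Nat.casesOn n y g
    have hf : Memℓp f 1 := memℓp_one_iff.2
      ((summable_nat_add_iff 1).1 (hasSum_norm_lp_one g).summable)
    exact ⟨⟨f, hf⟩, rfl⟩

/-- Every separable Banach space is a quotient of `ℓ₁`. -/
theorem exists_surjective_ellOne [CompleteSpace Y] [TopologicalSpace.SeparableSpace Y] :
    ∃ T : lp (fun _ : ℕ => 𝕜) 1 →L[𝕜] Y, Function.Surjective T := by
  -- A dense subgroup that is still countable: each `y ∈ K` lifts to a multiple of a unit vector of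
  -- norm `‖y‖`, and successive approximation extends lifting to all of `Y`.
  let K : AddSubgroup Y :=
    (Submodule.span ℤ (Set.range (TopologicalSpace.denseSeq Y))).toAddSubgroup
  have hK : K.topologicalClosure = ⊤ := by
    rw [eq_top_iff]
    intro y _
    exact closure_mono Submodule.subset_span (TopologicalSpace.denseRange_denseSeq Y y)
  have : Countable K :=
    inferInstanceAs (Countable (Submodule.span ℤ (Set.range (TopologicalSpace.denseSeq Y))))
  obtain ⟨k, hk⟩ := exists_surjective_nat K
  obtain ⟨T, hT⟩ := exists_ellOne_operator (𝕜 := 𝕜) (fun n => ((‖k n‖⁻¹ : ℝ) : 𝕜) • (k n : Y))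
    (C := 1) (fun n => by
      rw [norm_smul, RCLike.norm_ofReal, abs_of_nonneg (by positivity)]
      exact inv_mul_le_one)
  refine ⟨T, fun y => ?_⟩
  let f : NormedAddGroupHom (lp (fun _ : ℕ => 𝕜) 1) Y := 
    (T : lp (fun _ : ℕ => 𝕜) 1 →+ Y).mkNormedAddGroupHom ‖T‖ T.le_opNorm
  have hf : f.SurjectiveOnWith K 1 := by
    intro y hy
    obtain ⟨n, hn⟩ := hk ⟨y, hy⟩
    refine ⟨lp.single 1 n (‖y‖ : 𝕜), ?_, ?_⟩
    · refine (hT _).unique ?_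
      convert hasSum_single n ?_ using 1
      · rw [hn, lp.single_apply_self, smul_smul]
        rcases eq_or_ne y 0 with rfl | h
        · simp
        · have : ‖y‖ ≠ 0 := norm_ne_zero_iff.2 h
          rw [← RCLike.ofReal_mul, AddSubgroup.coe_norm, mul_inv_cancel₀ this]
          simp
      · intro m hm
        rw [lp.single_apply_ne _ _ _ hm, zero_smul]
    · rw [lp.norm_single one_pos]
      simp
  obtain ⟨a, ha, -⟩ := controlled_closure_of_complete one_pos one_pos hf y (hK ▸ trivial)
  exact ⟨a, ha⟩

end EllOne

/-! ### James' distortion theorem -/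

section James

variable {𝕜 : Type u} [RCLike 𝕜] {Y : Type u} [NormedAddCommGroup Y] [NormedSpace 𝕜 Y]

/-- The `ℓ₁`-norm of a finitely supported family of scalars. -/
noncomputable def oneNorm (b : ℕ →₀ 𝕜) : ℝ := b.sum fun _ r => ‖r‖

theorem oneNorm_nonneg (b : ℕ →₀ 𝕜) : 0 ≤ oneNorm b :=
  Finset.sum_nonneg fun _ _ => norm_nonneg _

theorem oneNorm_single (n : ℕ) (r : 𝕜) : oneNorm (Finsupp.single n r) = ‖r‖ := by
  simp [oneNorm]

theorem oneNorm_smul (c : 𝕜) (b : ℕ →₀ 𝕜) : oneNorm (c • b) = ‖c‖ * oneNorm b := by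
  unfold oneNorm
  rw [Finsupp.sum_smul_index (fun _ => norm_zero), Finsupp.mul_sum]
  simp

theorem oneNorm_add_of_disjoint {b b' : ℕ →₀ 𝕜} (h : Disjoint b.support b'.support) :
    oneNorm (b + b') = oneNorm b + oneNorm b' :=
  Finsupp.sum_add_index_of_disjoint h _

theorem oneNorm_sum_of_disjoint {y : ℕ → ℕ →₀ 𝕜}
    (hy : Pairwise fun m n => Disjoint (y m).support (y n).support) (b : ℕ → 𝕜) (t : Finset ℕ) :
    oneNorm (∑ k ∈ t, b k • y k) = ∑ k ∈ t, ‖b k‖ * oneNorm (y k) := by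
  induction t using Finset.induction_on with
  | empty => simp [oneNorm]
  | insert k t hk ih =>
    rw [Finset.sum_insert hk, Finset.sum_insert hk, oneNorm_add_of_disjoint, ih, oneNorm_smul]
    refine Disjoint.mono Finsupp.support_smul (Finsupp.support_finsetSum) ?_
    rw [Finset.disjoint_biUnion_right]
    exact fun j hj => (hy (ne_of_mem_of_not_mem hj hk).symm).mono_right Finsupp.support_smul

variable (𝕜) in
/-- A sequence in the unit ball satisfying a lower `ℓ₁`-estimate with constant `c`. -/
def IsEllOneSeq (c : ℝ) (x : ℕ → Y) : Prop :=
  (∀ n, ‖x n‖ ≤ 1) ∧ ∀ b : ℕ →₀ 𝕜, c * oneNorm b ≤ ‖Finsupp.linearCombination 𝕜 x b‖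

/-- **James' distortion theorem** for `ℓ₁`. -/
theorem IsEllOneSeq.improve {c : ℝ} (hc : 0 < c) {x : ℕ → Y} (hx : IsEllOneSeq 𝕜 c x)
    {θ : ℝ} (hθ : 0 < θ) (hθ1 : θ < 1) : ∃ y : ℕ → Y, IsEllOneSeq 𝕜 θ y := by
  set φ := Finsupp.linearCombination 𝕜 x with hφ
  -- The lower `ℓ₁`-constants valid off some finite set of indices; their supremum `l` is the
  -- asymptotic constant.
  let A : Set ℝ := {μ | ∃ S : Finset ℕ, ∀ b : ℕ →₀ 𝕜, Disjoint S b.support →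
    μ * oneNorm b ≤ ‖φ b‖}
  have hcA : c ∈ A := ⟨∅, fun b _ => hx.2 b⟩
  have hA : BddAbove A := by
    refine ⟨1, ?_⟩
    rintro μ ⟨S, hS⟩
    obtain ⟨n, hn⟩ := Infinite.exists_notMem_finset S
    have := hS (Finsupp.single n 1) (Disjoint.mono_right Finsupp.support_single_subset
      (Finset.disjoint_singleton_right.2 hn))
    rw [oneNorm_single, hφ, Finsupp.linearCombination_single, one_smul, norm_one, mul_one] at this
    exact this.trans (hx.1 n)
  set l := sSup A with hl
  have hl0 : 0 < l := hc.trans_le (le_csSup hA hcA)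
  -- Some `μ > l s` works off a finite `S`, while `ν = l / s > l` fails off every finite set. The
  -- failures give disjoint blocks of `ℓ₁`-norm `ν⁻¹` with images in the unit ball; off `S` these
  -- have lower constant `μ / ν ≥ s² = θ`.
  set s := √θ with hs
  have hs0 : 0 < s := Real.sqrt_pos.2 hθ
  have hss : s * s = θ := Real.mul_self_sqrt hθ.le
  have hs1 : s < 1 := by nlinarith
  obtain ⟨μ, ⟨S, hS⟩, hμ⟩ : ∃ μ ∈ A, l * s < μ :=
    exists_lt_of_lt_csSup ⟨c, hcA⟩ (by nlinarith)
  set ν := l / s with hν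
  have hν0 : 0 < ν := by positivity
  have hlν : l < ν := by rw [hν, lt_div_iff₀ hs0]; nlinarith
  have hνA : ν ∉ A := fun h => (le_csSup hA h).not_gt hlν
  have hblock : ∀ R : Finset ℕ, ∃ b : ℕ →₀ 𝕜, Disjoint R b.support ∧ ‖φ b‖ ≤ 1 ∧
      oneNorm b = ν⁻¹ := by
    intro R
    have : ∃ b : ℕ →₀ 𝕜, Disjoint R b.support ∧ ‖φ b‖ < ν * oneNorm b := by
      by_contra! h
      exact hνA ⟨R, h⟩
    obtain ⟨b, hb, hlt⟩ := this
    have hpos : 0 < ν * oneNorm b := (norm_nonneg _).trans_lt hlt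
    have hb0 : 0 < oneNorm b := pos_of_mul_pos_right hpos hν0.le
    have hn : ‖(((ν * oneNorm b)⁻¹ : ℝ) : 𝕜)‖ = (ν * oneNorm b)⁻¹ := by
      rw [RCLike.norm_ofReal, abs_of_pos (inv_pos.2 hpos)]
    refine ⟨(((ν * oneNorm b)⁻¹ : ℝ) : 𝕜) • b, hb.mono_right Finsupp.support_smul, ?_, ?_⟩
    · rw [map_smul, norm_smul, hn, inv_mul_le_iff₀ hpos, mul_one]
      exact hlt.le
    · rw [oneNorm_smul, hn]
      field_simp
  have : Std.Symm fun b b' : ℕ →₀ 𝕜 => Disjoint b.support b'.support := ⟨fun _ _ h => h.symm⟩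
  obtain ⟨y, hy, hdisj⟩ := exists_seq_of_forall_finset_exists'
    (fun b : ℕ →₀ 𝕜 => Disjoint S b.support ∧ ‖φ b‖ ≤ 1 ∧ oneNorm b = ν⁻¹)
    (fun b b' => Disjoint b.support b'.support) (by
      intro t _
      classical
      obtain ⟨b, hb, h1, h2⟩ := hblock (S ∪ t.biUnion Finsupp.support)
      rw [Finset.disjoint_union_left, Finset.disjoint_biUnion_left] at hb
      exact ⟨b, ⟨hb.1, h1, h2⟩, hb.2⟩)
  refine ⟨fun n => φ (y n), fun n => (hy n).2.1, fun b => ?_⟩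
  have hlc : Finsupp.linearCombination 𝕜 (fun n => φ (y n)) b =
      φ (∑ k ∈ b.support, b k • y k) := by
    rw [Finsupp.linearCombination_apply, Finsupp.sum, map_sum]
    simp
  have hS' : Disjoint S (∑ k ∈ b.support, b k • y k).support := by
    classical
    refine Disjoint.mono_right Finsupp.support_finsetSum ?_
    rw [Finset.disjoint_biUnion_right]
    exact fun k _ => (hy k).1.mono_right Finsupp.support_smul
  rw [hlc]
  refine le_trans ?_ (hS _ hS')
  rw [oneNorm_sum_of_disjoint hdisj]
  simp_rw [(hy _).2.2]
  rw [← Finset.sum_mul]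
  change θ * oneNorm b ≤ μ * (oneNorm b * ν⁻¹)
  have h1 : θ ≤ μ * ν⁻¹ := by
    rw [← div_eq_mul_inv, le_div_iff₀ hν0, hν, ← hss]
    have : s * s * (l / s) = l * s := by field_simp
    linarith
  nlinarith [oneNorm_nonneg b]

/-- An operator on `ℓ₁` which is bounded below gives an `ℓ₁`-sequence. -/
theorem exists_isEllOneSeq {K c : ℝ} (hK : 0 < K)
    (T : lp (fun _ : ℕ => 𝕜) 1 →L[𝕜] Y) (hT : ∀ a, ‖T a‖ ≤ K * ‖a‖) (hc : ∀ a, c * ‖a‖ ≤ ‖T a‖) :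
    IsEllOneSeq 𝕜 (K⁻¹ * c) fun n => ((K⁻¹ : ℝ) : 𝕜) • T (lp.single 1 n 1) := by
  have hn : ‖((K⁻¹ : ℝ) : 𝕜)‖ = K⁻¹ := by rw [RCLike.norm_ofReal, abs_of_pos (inv_pos.2 hK)]
  refine ⟨fun n => ?_, fun b => ?_⟩
  · rw [norm_smul, hn, inv_mul_le_iff₀ hK]
    refine (hT _).trans_eq ?_
    rw [lp.norm_single one_pos, norm_one]
  · have hlc : Finsupp.linearCombination 𝕜
        (fun n => ((K⁻¹ : ℝ) : 𝕜) • T (lp.single 1 n (1 : 𝕜))) b =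
        ((K⁻¹ : ℝ) : 𝕜) • T (∑ k ∈ b.support, lp.single 1 k (b k)) := by
      rw [Finsupp.linearCombination_apply, Finsupp.sum, map_sum, Finset.smul_sum]
      refine Finset.sum_congr rfl fun k _ => ?_
      rw [smul_comm, ← map_smul, ← lp.single_smul, smul_eq_mul, mul_one]
    have hnorm : ‖∑ k ∈ b.support, lp.single (E := fun _ : ℕ => 𝕜) 1 k (b k)‖ = oneNorm b := by
      have := lp.norm_sum_single (E := fun _ : ℕ => 𝕜) (p := 1) (by simp) b b.support
      simpa [oneNorm, Finsupp.sum] using this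
    rw [hlc, norm_smul, hn, mul_assoc, ← hnorm]
    exact mul_le_mul_of_nonneg_left (hc _) (inv_pos.2 hK).le

/-- An `ℓ₁`-sequence spans a copy of `ℓ₁`. -/
theorem IsEllOneSeq.exists_equiv [CompleteSpace Y] {c : ℝ} (hc : 0 < c) {x : ℕ → Y}
    (hx : IsEllOneSeq 𝕜 c x) :
    ∃ F : Submodule 𝕜 Y, Nonempty (lp (fun _ : ℕ => 𝕜) 1 ≃L[𝕜] F) := by
  obtain ⟨T, hT⟩ := exists_ellOne_operator (𝕜 := 𝕜) x hx.1
  have hlow : ∀ a, c * ‖a‖ ≤ ‖T a‖ := by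
    intro a
    -- The estimate holds for finite truncations of `a` and passes to the limit.
    refine le_of_tendsto_of_tendsto' ((hasSum_norm_lp_one a).mul_left c) (hT a).norm
      fun t => ?_
    have hb := hx.2 (Finsupp.indicator t fun n _ => a n)
    rw [oneNorm, Finsupp.linearCombination_apply,
      Finsupp.sum_indicator_index_eq_sum_attach _ (fun _ _ => norm_zero),
      Finsupp.sum_indicator_index_eq_sum_attach (h := fun n r => r • x n) _
        (fun _ _ => zero_smul _ _),
      Finset.sum_attach t (fun n => ‖a n‖), Finset.sum_attach t (fun n => a n • x n)] at hb
    rwa [← Finset.mul_sum]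
  have hanti : AntilipschitzWith (Real.toNNReal c⁻¹) T := by
    refine AddMonoidHomClass.antilipschitz_of_bound T fun a => ?_
    rw [Real.coe_toNNReal _ (inv_pos.2 hc).le, ← div_eq_inv_mul, le_div_iff₀' hc]
    exact hlow a
  exact ⟨_, ⟨T.equivRange hanti.injective (hanti.isClosed_range T.uniformContinuous)⟩⟩

end James

/-! ### Stability under small Kadets distance -/

section Perturbation

variable {𝕜 : Type u} [RCLike 𝕜]

theorem containsCopy_ellOne_iff (Y : BanachSpace 𝕜) :
    ContainsCopy Y (ellOne 𝕜) ↔ ∃ c > 0, ∃ x : ℕ → Y, IsEllOneSeq 𝕜 c x := by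
  constructor
  · rintro ⟨F, ⟨e⟩⟩
    let e' : lp (fun _ : ℕ => 𝕜) 1 ≃L[𝕜] F := e
    let T : lp (fun _ : ℕ => 𝕜) 1 →L[𝕜] Y := F.subtypeL.comp (e' : _ →L[𝕜] F)
    let N := ‖(e'.symm : F →L[𝕜] lp (fun _ : ℕ => 𝕜) 1)‖ + 1
    have hN : 0 < N := by positivity
    refine ⟨(‖T‖ + 1)⁻¹ * N⁻¹, by positivity, _, exists_isEllOneSeq (by positivity) T
      (fun a => (T.le_opNorm a).trans ?_) fun a => ?_⟩
    · gcongr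
      linarith
    · rw [inv_mul_le_iff₀ hN]
      have := (e'.symm : F →L[𝕜] lp (fun _ : ℕ => 𝕜) 1).le_opNorm (e' a)
      simp only [ContinuousLinearEquiv.coe_coe, ContinuousLinearEquiv.symm_apply_apply] at this
      refine this.trans ?_
      change _ * ‖T a‖ ≤ N * ‖T a‖
      gcongr
      simp [N]
  · rintro ⟨c, hc, x, hx⟩
    exact hx.exists_equiv hc

/-- Moving each `x n` by less than `ε` in a common superspace moves a combination by at most `ε`
times the `ℓ₁`-norm of its coefficients. -/
theorem IsEllOneSeq.perturb {X Y : BanachSpace 𝕜} {ε c : ℝ} (h : kadetsDist X Y < ε) {x : ℕ → X}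
    (hx : IsEllOneSeq 𝕜 c x) : ∃ y : ℕ → Y, IsEllOneSeq 𝕜 (c - ε) y := by
  obtain ⟨Z, U, V, hUV⟩ := exists_embeddings_of_kadetsDist_lt h
  choose y hy1 hy2 using fun n => hUV (x n) (hx.1 n)
  refine ⟨y, hy1, fun b => ?_⟩
  have hd : ‖U (Finsupp.linearCombination 𝕜 x b) - V (Finsupp.linearCombination 𝕜 y b)‖ ≤
      oneNorm b * ε := by
    rw [Finsupp.linearCombination_apply, Finsupp.linearCombination_apply, Finsupp.sum, Finsupp.sum,
      map_sum, map_sum, ← Finset.sum_sub_distrib, oneNorm, Finsupp.sum, Finset.sum_mul]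
    refine norm_sum_le_of_le _ fun k _ => ?_
    rw [map_smul, map_smul, ← smul_sub, norm_smul]
    exact mul_le_mul_of_nonneg_left (hy2 k).le (norm_nonneg _)
  have h1 := hx.2 b
  have h2 := norm_sub_norm_le (U (Finsupp.linearCombination 𝕜 x b))
    (V (Finsupp.linearCombination 𝕜 y b))
  rw [U.norm_map, V.norm_map] at h2
  linarith

/-- Distortion makes the radius independent of the constant of the given copy; this uniformity gives
closedness as well as openness. -/
theorem ContainsCopy.of_kadetsDist_lt {X Y : BanachSpace 𝕜} (h : kadetsDist X Y < 1 / 4)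
    (hX : ContainsCopy X (ellOne 𝕜)) : ContainsCopy Y (ellOne 𝕜) := by
  rw [containsCopy_ellOne_iff] at hX ⊢
  obtain ⟨c, hc, x, hx⟩ := hX
  obtain ⟨x', hx'⟩ := hx.improve hc (θ := 1 / 2) (by norm_num) (by norm_num)
  obtain ⟨y, hy⟩ := hx'.perturb h
  exact ⟨_, by norm_num, y, hy⟩

theorem separableSpace_of_kadetsDist_lt {X Y : BanachSpace 𝕜} (h : kadetsDist X Y < 1 / 4)
    [TopologicalSpace.SeparableSpace X] : TopologicalSpace.SeparableSpace Y := by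
  obtain ⟨Z, U, V, hUV⟩ := exists_embeddings_of_kadetsDist_lt (kadetsDist_comm X Y ▸ h)
  let d := TopologicalSpace.denseSeq X
  -- Here `3/8 = 1/4 + 1/8`, the distance bound plus the density error. Two points related to the
  -- same `d n` are within `3/4 < 1`, so Riesz's lemma forces the closed span of the chosen points
  -- to be everything.
  let R : ℕ → Y → Prop := fun n y => ‖U y - V (d n)‖ < 3 / 8
  classical
  let g : ℕ → Y := fun n => if h : ∃ y, R n y then h.choose else 0
  have hg : ∀ n y, R n y → R n (g n) := by
    intro n y hy
    have h : ∃ y, R n y := ⟨y, hy⟩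
    simp only [g, dif_pos h]
    exact h.choose_spec
  have hnear : ∀ y : Y, ‖y‖ ≤ 1 → ∃ n, ‖y - g n‖ < 3 / 4 := by
    intro y hy
    obtain ⟨x, -, hx⟩ := hUV y hy
    obtain ⟨n, hn⟩ := (TopologicalSpace.denseRange_denseSeq X).exists_dist_lt x
      (show (0 : ℝ) < 1 / 8 by norm_num)
    have hRy : R n y := by
      have h1 : ‖V x - V (d n)‖ < 1 / 8 := by
        rw [← map_sub, V.norm_map, ← dist_eq_norm]
        exact hn
      have h2 := norm_sub_le_norm_sub_add_norm_sub (U y) (V x) (V (d n))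
      change ‖U y - V (d n)‖ < 3 / 8
      linarith
    have h3 : ‖U (g n) - V (d n)‖ < 3 / 8 := hg n y hRy
    have h4 := norm_sub_le_norm_sub_add_norm_sub (U y) (V (d n)) (U (g n))
    rw [← map_sub, U.norm_map, norm_sub_rev (V (d n))] at h4
    have h5 : ‖U y - V (d n)‖ < 3 / 8 := hRy
    exact ⟨n, by linarith⟩
  let M : Submodule 𝕜 Y := (Submodule.span 𝕜 (Set.range g)).topologicalClosure
  have hM : ∀ y, y ∈ M := by
    by_contra! hne
    obtain ⟨y, -, hy1, hy⟩ := riesz_lemma_of_lt_one (F := M)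
      (Submodule.isClosed_topologicalClosure _) hne (show (3 / 4 : ℝ) < 1 by norm_num)
    obtain ⟨n, hn⟩ := hnear y hy1.le
    have := hy (g n) (Submodule.le_topologicalClosure _ (Submodule.subset_span ⟨n, rfl⟩))
    linarith
  have hsep : TopologicalSpace.IsSeparable (M : Set Y) :=
    ((Set.countable_range g).isSeparable.span (R := 𝕜)).closure
  rw [← TopologicalSpace.isSeparable_univ_iff]
  exact hsep.mono fun y _ => hM y

end Perturbation

/-! ### The component of `ℓ₁` -/

section Component

variable {𝕜 : Type u} [RCLike 𝕜]

theorem isClopenProperty_separable_containsCopy :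
    IsClopenProperty {X : BanachSpace 𝕜 |
      TopologicalSpace.SeparableSpace X ∧ ContainsCopy X (ellOne 𝕜)} := by
  have key : ∀ X Y : BanachSpace 𝕜, kadetsDist X Y < 1 / 4 →
      (TopologicalSpace.SeparableSpace X ∧ ContainsCopy X (ellOne 𝕜)) →
      (TopologicalSpace.SeparableSpace Y ∧ ContainsCopy Y (ellOne 𝕜)) := by
    rintro X Y h ⟨_, h'⟩
    exact ⟨separableSpace_of_kadetsDist_lt h, h'.of_kadetsDist_lt h⟩
  intro κ
  refine ⟨⟨fun X hX => ?_⟩, fun X hX => ?_⟩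
  · refine ⟨1 / 4, by norm_num, fun Y hY hmem => hX (key _ _ ?_ hmem)⟩
    rwa [kadetsDist_comm]
  · exact ⟨1 / 4, by norm_num, fun Y hY => key _ _ hY hX⟩

theorem separableSpace_ellOne : TopologicalSpace.SeparableSpace (ellOne 𝕜) :=
  inferInstanceAs (TopologicalSpace.SeparableSpace (lp (fun _ : ℕ => 𝕜) 1))

theorem containsCopy_refl (X : BanachSpace 𝕜) : ContainsCopy X X :=
  ⟨⊤, ⟨(LinearIsometryEquiv.ofTop X.carrier (⊤ : Submodule 𝕜 X) rfl).symm.toContinuousLinearEquiv⟩⟩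

/-- If `Q : E → X` is onto, then `E` is linked with `ker Q × X`. -/
theorem linked_prod_of_equiv_ker {E X M : BanachSpace 𝕜} (Q : E →L[𝕜] X)
    (hQ : Function.Surjective Q) (e : Q.ker ≃L[𝕜] M) : Linked E ⟨M × X⟩ := by
  have h := linked_ker_prod (M := ofClosed E Q.ker Q.isClosed_ker) Q hQ Q.ker.subtypeₗᵢ
    Q.ker.range_subtype
  refine h.trans (linked_of_equiv (Y := ⟨M × X⟩) ?_)
  exact e.prodCongr (ContinuousLinearEquiv.refl 𝕜 X)

/-- Adding a separable summand to `ℓ₁` does not change its component. -/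
theorem linked_ellOne_prod (Y : BanachSpace 𝕜) [TopologicalSpace.SeparableSpace Y] :
    Linked (ellOne 𝕜) ⟨ellOne 𝕜 × Y⟩ := by
  let W : BanachSpace 𝕜 := ⟨lp (fun _ : ℕ => Y) 1⟩
  obtain ⟨e⟩ := nonempty_lp_one_equiv_prod (𝕜 := 𝕜) (Y := Y)
  obtain ⟨q, hq⟩ := exists_surjective_ellOne (𝕜 := 𝕜) (Y := lp (fun _ : ℕ => Y) 1)
  let Q : ellOne 𝕜 →L[𝕜] W := q
  let M : BanachSpace 𝕜 := ofClosed (ellOne 𝕜) Q.ker Q.isClosed_ker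
  let E : BanachSpace 𝕜 := ⟨ellOne 𝕜 × Y⟩
  have h1 : Linked (ellOne 𝕜) ⟨M × W⟩ :=
    linked_prod_of_equiv_ker Q hq (ContinuousLinearEquiv.refl 𝕜 _)
  -- `(a, y) ↦ e⁻¹(Q a, y)` uses `W × Y ≅ W` to hide `Y` in the target, so the kernel is `ker Q ×
  -- 0`.
  let Φ : E →L[𝕜] W :=
    (e.symm : _ →L[𝕜] lp (fun _ : ℕ => Y) 1).comp (Q.prodMap (ContinuousLinearMap.id 𝕜 Y))
  have hΦ : Function.Surjective Φ :=
    e.symm.surjective.comp (hq.prodMap Function.surjective_id)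
  have hker : ∀ a : ellOne 𝕜, ∀ y : Y, (a, y) ∈ Φ.ker ↔ a ∈ Q.ker ∧ y = 0 := by
    intro a y
    change e.symm (Q a, y) = 0 ↔ Q a = 0 ∧ y = 0
    rw [map_eq_zero_iff _ e.symm.injective, Prod.mk_eq_zero]
  have h2 : Linked E ⟨M × W⟩ := by
    refine linked_ker_prod (M := M) Φ hΦ
      ⟨(LinearMap.inl 𝕜 (ellOne 𝕜) Y).comp Q.ker.subtype, fun x => ?_⟩ ?_
    · change ‖((x.1 : ellOne 𝕜), (0 : Y))‖ = ‖(x.1 : ellOne 𝕜)‖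
      simp [Prod.norm_def]
    · ext ⟨a, y⟩
      rw [hker]
      constructor
      · rintro ⟨m, hm⟩
        have h1 : m.1 = a := congrArg Prod.fst hm
        have h2 : (0 : Y) = y := congrArg Prod.snd hm
        exact ⟨h1 ▸ m.2, h2.symm⟩
      · rintro ⟨ha, rfl⟩
        exact ⟨⟨a, ha⟩, rfl⟩
  exact h1.trans h2.symm

/-- A copy `F` of `ℓ₁` is complete, hence closed, and is the kernel of `X → X/F`. Thus `X` is linked
with `ℓ₁ × X/F`, whose separable second factor is absorbed. -/
theorem linked_of_containsCopy {X : BanachSpace 𝕜} [TopologicalSpace.SeparableSpace X]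
    (h : ContainsCopy X (ellOne 𝕜)) : Linked (ellOne 𝕜) X := by
  obtain ⟨F, ⟨e⟩⟩ := h
  have hF : IsClosed (F : Set X) := by
    have : CompleteSpace F := 
      (completeSpace_congr (e := e.symm.toEquiv) e.symm.isUniformEmbedding).2 inferInstance
    exact (completeSpace_coe_iff_isComplete.1 this).isClosed
  have : IsClosed (F : Set X) := hF
  let Y : BanachSpace 𝕜 := ⟨X ⧸ F⟩
  have : TopologicalSpace.SeparableSpace Y :=
    F.mkQ_surjective.denseRange.separableSpace F.mkQL.continuous
  have hker : F.mkQL.ker = F := F.ker_mkQ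
  have h1 : Linked X ⟨ellOne 𝕜 × Y⟩ :=
    linked_prod_of_equiv_ker (X := Y) F.mkQL F.mkQ_surjective
      ((ContinuousLinearEquiv.ofEq _ _ hker).trans e.symm)
  exact (linked_ellOne_prod Y).trans h1.symm

end Component

end KadetsDistance

theorem proposition5p8 {𝕜 : Type*} [RCLike 𝕜] (X : KadetsDistance.BanachSpace 𝕜) :
    X ∈ KadetsDistance.kadetsComponent (KadetsDistance.ellOne 𝕜) ↔
      TopologicalSpace.SeparableSpace X ∧
        KadetsDistance.ContainsCopy X (KadetsDistance.ellOne 𝕜) := by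
  constructor
  · intro h
    exact h _ ⟨KadetsDistance.isClopenProperty_separable_containsCopy,
      KadetsDistance.separableSpace_ellOne, KadetsDistance.containsCopy_refl _⟩
  · rintro ⟨_, h⟩
    exact (KadetsDistance.linked_of_containsCopy h).mem_component
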